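/- Let $d\ge 1$, let $\Omega\subset\mathbb{R}^d$ be a bounded domain contained in the ball $B_{R_0}$ of radius $R_0$ centred at the origin, $\omega=\mathbb{R}^d\setminus\overline\Omega$, $0<T<\infty$, and $K_1,K_2\in\mathbb R$. Then there are positive constants $C_T,C_1,C_2,C_1',C_2'$, depending only on $d,\Omega,R_0,T,K_1,K_2$, such that the following holds for every $T_D\in(T,\infty]$ and all $\kappa_1\in C^1([0,T])$ bounded below by a positive constant and $0\le\kappa_2\in C([0,T])$ with $|\kappa_1|,|\kappa_1'|\le K_1$ and $\kappa_2\le K_2$ on $[0,T]$ whose Hamiltonian flow is non-zero on $[0,S]$ for every $0<S<T_D$. Here the flow is non-zero on $[0,S]$ if the solution of $x_i'=2\kappa_1p_i$, $p_i'=-2\kappa_2x_i$, $x_i(0)=1$, $p_i(0)=0$ ($1\le i\le d$) has $x_i\ne0$ on $[0,S]$ and $\exp(-\int_0^t p_i\kappa_1/x_i\,ds)$ is bounded there. Let $y_1,y_2,y_3$ solve $y_1'=-4\kappa_1y_1^2-\kappa_2$, $y_2'=-4\kappa_1y_1y_2$, $y_3'=-\kappa_1y_2^2$ on $[0,T]$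 with $y_1(0)=y_3(0)=0$, $y_2(0)=1$, and put $A=2|y_2|^2/(1+16y_3^2)$. For $N\in\mathbb N$, $N>2$, and $\varepsilon>0$ consider the condition $$(\ast)\qquad \varepsilon N\left[\frac{\sqrt{1+16y_3^2}}{2|y_2|}\,e^{\frac{2|y_2|^2R_0^2+2|y_2|NR_0}{1+16y_3^2}}+\sqrt{2\pi}\,\frac{N+1}{|y_2|}\,e^{\frac{2N^2}{1+16y_3^2}}\right]\le\frac12\int_{R_0}^\infty e^{-Ar^2}\,dr\qquad\text{for all }t\in[0,T].$$ (i) Let $B$ be the space of $f\in L^2(\mathbb R^d)$ with $x^\alpha D^\beta f\in L^2$ for all $|\alpha+\beta|\le2$. Let $u_0\in B$ and suppose that for some $N>2$, $\eta\in(0,1)$, $\varepsilon>0$ satisfying $(\ast)$ and some $c_n\ge0$ $$\Big\|u_0-\sum_{|n|\le N}c_n e^{-|x+\varepsilon n|^2}\Big\|_{L^2(\mathbb R^d)}\le\eta,\qquad n\in\{0,\dots,N\}^d$$ ($|n|$ the Euclidean length). Let $u\in C([0,T];B)\cap C^1([0,T];L^2(\mathbb R^d))$ solve $\partial_tu+i(-\kappa_1(t)\Delta+\kappa_2(t)|x|^2)u=0$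 in $L^2$ for $0<t\le T$, with $u(0)=u_0$. Then $$\|u_0\|_{L^2(\mathbb R^d)}-\eta\le C_T\left(\|u\|_{L^2((0,T)\times\omega)}+T\eta\right).$$ (ii) If $2<N<\tfrac12\operatorname{diam}\Omega$ and $0<\varepsilon\le e^{-C_1N}/(C_2N)$, then $(\ast)$ holds. Conversely, for every $N>2$ and $\varepsilon>0$, $(\ast)$ implies $\varepsilon\le e^{-C_1'N}/(C_2'N)$. -/

import Mathlib

open MeasureTheory Set
open scoped SchwartzMap LineDeriv Laplacian

noncomputable section

namespace Oscillator

/-- `ℝ^d` with its Euclidean norm. -/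
abbrev Space (d : ℕ) : Type := EuclideanSpace ℝ (Fin d)

/-- The complex Hilbert space `L²(ℝ^d)`. -/
abbrev L2 (d : ℕ) : Type := Lp ℂ 2 (volume : Measure (Space d))

/-- An element of `L²(ℝ^d)` regarded as a tempered distribution. -/
def toDist {d : ℕ} (f : L2 d) : 𝓢'(Space d, ℂ) := Lp.toTemperedDistribution f

/-- The length `|α| = α₁ + ⋯ + α_d` of a multi-index. -/
def multiLength {d : ℕ} (α : Fin d → ℕ) : ℕ := ∑ i, α i

/-- `D^β = (-i)^{|β|} ∂₁^{β₁} ⋯ ∂_d^{β_d}` acting on tempered distributions. -/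
def distDeriv {d : ℕ} (β : Fin d → ℕ) : 𝓢'(Space d, ℂ) →L[ℂ] 𝓢'(Space d, ℂ) :=
  ((-Complex.I) ^ multiLength β) •
    (List.ofFn fun i : Fin d =>
      (LineDeriv.lineDerivOpCLM ℂ 𝓢'(Space d, ℂ)
        (EuclideanSpace.single i (1 : ℝ) : Space d)) ^ β i).prod

/-- The tempered distribution `x^α D^β f` for `f ∈ L²(ℝ^d)`. -/
def momentDeriv {d : ℕ} (α β : Fin d → ℕ) (f : L2 d) : 𝓢'(Space d, ℂ) :=
  TemperedDistribution.smulLeftCLM ℂ (fun x : Space d => ∏ i, ((x i : ℝ) : ℂ) ^ α i)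
    (distDeriv β (toDist f))

/-- Membership in the weighted Sobolev space
`B = {f ∈ L² : x^α D^β f ∈ L² for all |α + β| ≤ 2}`. -/
def MemB {d : ℕ} (f : L2 d) : Prop :=
  ∀ α β : Fin d → ℕ, multiLength (α + β) ≤ 2 → ∃ g : L2 d, momentDeriv α β f = toDist g

/-- `u` is a `B`-valued solution on `[0,T]` of `∂_t u + i L u = 0`,
`L = -κ₁(t) Δ + κ₂(t) |x|²`, with initial value `u₀`. Field `cont_B` is continuity for the norm
`‖f‖_B² = ∑_{|α+β| = 2} ‖x^α D^β f‖²`. The equation is an identity between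
elements of `L²`, read off in the tempered distributions, into which `L²` embeds. -/
structure IsBValuedSolution {d : ℕ} (κ₁ κ₂ : ℝ → ℝ) (T : ℝ) (u₀ : L2 d) (u : ℝ → L2 d) :
    Prop where
  mem_B : ∀ t ∈ Icc 0 T, MemB (u t)
  cont_B : ∀ α β : Fin d → ℕ, multiLength (α + β) = 2 →
    ∃ g : ℝ → L2 d, ContinuousOn g (Icc 0 T) ∧
      ∀ t ∈ Icc 0 T, momentDeriv α β (u t) = toDist (g t)
  contDiff : ContDiffOn ℝ 1 u (Icc 0 T)
  initial : u 0 = u₀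
  equation : ∀ t ∈ Ioc 0 T,
    toDist (derivWithin u (Icc 0 T) t) +
      Complex.I • (-((κ₁ t : ℂ) • Δ (toDist (u t))) +
        (κ₂ t : ℂ) • TemperedDistribution.smulLeftCLM ℂ
          (fun x : Space d => ((‖x‖ ^ 2 : ℝ) : ℂ)) (toDist (u t))) = 0

/-- The norm of `u` in `L²((0,T) × ω)`. -/
def spaceTimeNorm {d : ℕ} (u : ℝ → L2 d) (T : ℝ) (ω : Set (Space d)) : ℝ :=
  Real.sqrt (∫ t in Ioo 0 T, ∫ x in ω, ‖u t x‖ ^ 2)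

/-- `(x,p)` is the trajectory on `[0,S]` of the Hamiltonian `κ₁(t)|p|² + κ₂(t)|x|²` issued
from `x(0) = (1,…,1)`, `p(0) = (0,…,0)`. -/
structure IsHamiltonianTrajectory {d : ℕ} (κ₁ κ₂ : ℝ → ℝ) (S : ℝ) (x p : ℝ → Fin d → ℝ) :
    Prop where
  x_init : ∀ i, x 0 i = 1
  p_init : ∀ i, p 0 i = 0
  x_deriv : ∀ t ∈ Icc 0 S, ∀ i,
    HasDerivWithinAt (fun s => x s i) (2 * κ₁ t * p t i) (Icc 0 S) t
  p_deriv : ∀ t ∈ Icc 0 S, ∀ i,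
    HasDerivWithinAt (fun s => p s i) (-2 * κ₂ t * x t i) (Icc 0 S) t

/-- The Hamiltonian flow is non-zero on `[0,S]`: no coordinate of the (unique) trajectory vanishes
there, and the amplitude `exp(-∫₀ᵗ p_i κ₁ / x_i)` is bounded. -/
def FlowNonzero (d : ℕ) (κ₁ κ₂ : ℝ → ℝ) (S : ℝ) : Prop :=
  ∃ x p : ℝ → Fin d → ℝ, IsHamiltonianTrajectory κ₁ κ₂ S x p ∧
    (∀ t ∈ Icc 0 S, ∀ i, x t i ≠ 0) ∧
    ∃ M : ℝ, ∀ t ∈ Icc 0 S, ∀ i,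
      Real.exp (-∫ s in (0 : ℝ)..t, p s i * κ₁ s / x s i) ≤ M

/-- `y₁, y₂, y₃` solve on `[0,T]` the Riccati system
`y₁' = -4κ₁y₁² - κ₂`, `y₂' = -4κ₁y₁y₂`, `y₃' = -κ₁y₂²`, `(y₁,y₂,y₃)(0) = (0,1,0)`. -/
structure IsRiccatiSolution (κ₁ κ₂ : ℝ → ℝ) (T : ℝ) (y₁ y₂ y₃ : ℝ → ℝ) : Prop where
  init₁ : y₁ 0 = 0
  init₂ : y₂ 0 = 1
  init₃ : y₃ 0 = 0
  deriv₁ : ∀ t ∈ Icc 0 T,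
    HasDerivWithinAt y₁ (-4 * κ₁ t * y₁ t ^ 2 - κ₂ t) (Icc 0 T) t
  deriv₂ : ∀ t ∈ Icc 0 T, HasDerivWithinAt y₂ (-4 * κ₁ t * y₁ t * y₂ t) (Icc 0 T) t
  deriv₃ : ∀ t ∈ Icc 0 T, HasDerivWithinAt y₃ (-κ₁ t * y₂ t ^ 2) (Icc 0 T) t

/-- `A = 2|y₂|² / (1 + 16 y₃²)`. -/
def spread (y₂ y₃ : ℝ) : ℝ := 2 * |y₂| ^ 2 / (1 + 16 * y₃ ^ 2)

/-- The smallness condition on `ε` at one time, `y₂` and `y₃` being the values at that time. -/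
def SmallSpacing (R₀ : ℝ) (N : ℕ) (ε y₂ y₃ : ℝ) : Prop :=
  ε * N * (Real.sqrt (1 + 16 * y₃ ^ 2) / (2 * |y₂|) *
        Real.exp ((2 * |y₂| ^ 2 * R₀ ^ 2 + 2 * |y₂| * N * R₀) / (1 + 16 * y₃ ^ 2)) +
      Real.sqrt (2 * Real.pi) * ((N + 1) / |y₂|) *
        Real.exp (2 * (N : ℝ) ^ 2 / (1 + 16 * y₃ ^ 2)))
    ≤ 1 / 2 * ∫ r in Ioi R₀, Real.exp (-spread y₂ y₃ * r ^ 2)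

/-- A multi-index as a point of `ℝ^d`. -/
def latticePoint {d : ℕ} (n : Fin d → ℕ) : Space d := WithLp.toLp 2 fun i => (n i : ℝ)

/-- The multi-indices `n` with `n_i ∈ {0,…,N}` and `|n| ≤ N`, with `|n|` the Euclidean length. -/
def indexSet (d N : ℕ) : Finset (Fin d → ℕ) :=
  (Fintype.piFinset fun _ => Finset.range (N + 1)).filter fun n => ∑ i, n i ^ 2 ≤ N ^ 2

/-- `f` lies in the admissible class, as witnessed by the number `N > 2`, the error `η ∈ (0,1)`,
the centres `a_n` and the coefficients `c_n ≥ 0`. -/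
structure IsAdmissible {d : ℕ} (N : ℕ) (η : ℝ) (a : (Fin d → ℕ) → Space d)
    (c : (Fin d → ℕ) → ℝ) (f : L2 d) : Prop where
  two_lt : 2 < N
  η_pos : 0 < η
  η_lt_one : η < 1
  coeff_nonneg : ∀ n ∈ indexSet d N, 0 ≤ c n
  memB : MemB f
  approx : eLpNorm (fun x => f x -
      ((∑ n ∈ indexSet d N, c n * Real.exp (-‖x + a n‖ ^ 2) : ℝ) : ℂ)) 2 volume
    ≤ ENNReal.ofReal η

end Oscillator

end

/-! ### Distributional identities in `L²` and symmetry of the generator. -/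

namespace Oscillator

open scoped FourierTransform

variable {d : ℕ}

/-! The observability estimate follows from a short-time argument with one fixed test function; the
evolved Gaussians are never computed. Take a bump `φ ≥ 0` supported outside the ball
(`exists_bump`). For a superposition `f` with non-negative coefficients of sum `S` and centres of
norm at most `δ`, nothing cancels: `‖f‖ ≤ γS` (`norm_superposition_le`), while the pairing with `φ`
is at least `βS` (`le_pairing_superposition`). Along a solution the norm does not grow (`norm_le`),
so, by moving `Δ` and `|x|²` onto `φ`, the pairing drops by at most `L‖u₀‖t` (`pairing_ge`). Up to a
time `t₀` fixed in advance it keeps half of `βS`, up to multiples of `η`, and only the exterior part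
of `u t` contributes to it. Integration over `(0, t₀)` bounds `S`, hence `‖u₀‖`. The smallness
condition enters only through its value at `t = 0`, which keeps the centres `εn` in a fixed ball.

For the sufficient size of `ε`, the substitution `1/y₂`, `y₃/y₂` turns the Riccati system into a
linear Hamiltonian one. Gronwall and the constant Wronskian bound the Gaussian width on both sides
(`width_bounds`), and `N < R₀` bounds everything else. The necessary size is read off at `t = 0`. -/

theorem toDist_apply (f : L2 d) (φ : 𝓢(Space d, ℂ)) : toDist f φ = ∫ x, φ x * f x := by
  simp [toDist]

theorem toDist_add (f g : L2 d) : toDist (f + g) = toDist f + toDist g :=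
  map_add (Lp.toTemperedDistributionCLM ℂ volume 2) f g

theorem toDist_smul (c : ℂ) (f : L2 d) : toDist (c • f) = c • toDist f :=
  map_smul (Lp.toTemperedDistributionCLM ℂ volume 2) c f

theorem toDist_sum {ι : Type*} (s : Finset ι) (f : ι → L2 d) :
    toDist (∑ i ∈ s, f i) = ∑ i ∈ s, toDist (f i) :=
  map_sum (Lp.toTemperedDistributionCLM ℂ volume 2) f s

/-- The pairing of `L²` with a Schwartz function, as a continuous linear functional. -/
noncomputable def pairing (φ : 𝓢(Space d, ℂ)) : L2 d →L[ℂ] ℂ :=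
  (PointwiseConvergenceCLM.evalCLM (RingHom.id ℂ) ℂ φ).comp
    (Lp.toTemperedDistributionCLM ℂ volume 2)

theorem pairing_apply (φ : 𝓢(Space d, ℂ)) (f : L2 d) : pairing φ f = toDist f φ := rfl

/-- If `m f = g` holds in the tempered distributions, it holds almost everywhere. -/
theorem ae_eq_mul_of_smulLeftCLM {m : Space d → ℂ} (hm : m.HasTemperateGrowth) {f g : L2 d}
    (h : TemperedDistribution.smulLeftCLM ℂ m (toDist f) = toDist g) :
    ∀ᵐ x, g x = m x * f x := by
  apply ae_eq_of_integral_contDiff_smul_eq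
  · exact (Lp.memLp g).locallyIntegrable (by norm_num)
  · have hf : LocallyIntegrable f := (Lp.memLp f).locallyIntegrable (by norm_num)
    exact hf.continuous_mul hm.1.continuous
  · intro ψ hψ hc
    have hg₁ : HasCompactSupport (Complex.ofRealCLM ∘ ψ) := hc.comp_left rfl
    have hg₂ := Complex.ofRealCLM.contDiff.comp hψ
    have h1 := congrArg (fun F => F (hg₁.toSchwartzMap hg₂)) h
    simp only [TemperedDistribution.smulLeftCLM_apply_apply, toDist_apply,
      SchwartzMap.smulLeftCLM_apply_apply hm] at h1
    simp only [HasCompactSupport.toSchwartzMap_toFun, Function.comp_apply, smul_eq_mul,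
      Complex.ofRealCLM_apply] at h1
    simp only [Complex.real_smul]
    rw [← h1]
    refine integral_congr_ae (Filter.Eventually.of_forall fun x => ?_)
    simp only
    ring

theorem inner_im_eq_zero_of_ae_eq_mul {m : Space d → ℝ} {f g : L2 d}
    (h : ∀ᵐ x, g x = (m x : ℂ) * f x) : (inner ℂ f g).im = 0 := by
  have : inner ℂ f g = ∫ x, ((m x * ‖f x‖ ^ 2 : ℝ) : ℂ) := by
    rw [L2.inner_def]
    refine integral_congr_ae ?_
    filter_upwards [h] with x hx
    rw [hx, RCLike.inner_apply, mul_assoc, RCLike.mul_conj]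
    simp
  rw [this, integral_complex_ofReal]
  exact Complex.ofReal_im _

theorem hasTemperateGrowth_norm_sq :
    (fun x : Space d => ((‖x‖ ^ 2 : ℝ) : ℂ)).HasTemperateGrowth := by fun_prop

/-- Multiplication by `|x|²` is symmetric. -/
theorem inner_normSq_im_eq_zero {f g : L2 d}
    (h : TemperedDistribution.smulLeftCLM ℂ (fun x : Space d => ((‖x‖ ^ 2 : ℝ) : ℂ)) (toDist f)
      = toDist g) : (inner ℂ f g).im = 0 :=
  inner_im_eq_zero_of_ae_eq_mul (m := fun x => ‖x‖ ^ 2)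
    (ae_eq_mul_of_smulLeftCLM hasTemperateGrowth_norm_sq h)

/-- The Laplacian is symmetric on its maximal domain in `L²`. -/
theorem inner_laplacian_im_eq_zero {f g : L2 d} (h : Δ (toDist f) = toDist g) :
    (inner ℂ f g).im = 0 := by
  rw [TemperedDistribution.laplacian_eq_fourierMultiplierCLM,
    TemperedDistribution.fourierMultiplierCLM_apply] at h
  have hF : ∀ f : L2 d, 𝓕 (toDist f) = toDist (𝓕 f) := fun f =>
    (Lp.fourier_toTemperedDistribution_eq f)
  -- On the Fourier side `Δ` is multiplication by `-(2π)²|ξ|²`; dividing by this real constant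
  -- reduces the claim to the symmetry of `|ξ|²`, and Plancherel transfers it back.
  have h2 : TemperedDistribution.smulLeftCLM ℂ (fun x : Space d => ((‖x‖ ^ 2 : ℝ) : ℂ))
      (toDist (𝓕 f)) = toDist ((-((2 * Real.pi : ℝ) : ℂ) ^ 2)⁻¹ • 𝓕 g) := by
    rw [toDist_smul, ← hF g, ← hF f, ← h, ← Complex.coe_smul, FourierTransform.fourier_smul,
      FourierTransform.fourier_fourierInv_eq, smul_smul]
    have : ((2 * Real.pi : ℝ) : ℂ) ≠ 0 := by
      exact_mod_cast Real.two_pi_pos.ne'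
    rw [show ((-(2 * Real.pi) ^ 2 : ℝ) : ℂ) = -((2 * Real.pi : ℝ) : ℂ) ^ 2 by push_cast; ring,
      inv_mul_cancel₀ (neg_ne_zero.mpr (pow_ne_zero 2 this)), one_smul]
  have h3 := inner_normSq_im_eq_zero h2
  rw [inner_smul_right, Lp.inner_fourier_eq,
    show (-((2 * Real.pi : ℝ) : ℂ) ^ 2)⁻¹ = (((-(2 * Real.pi) ^ 2)⁻¹ : ℝ) : ℂ) by push_cast; ring,
    Complex.im_ofReal_mul] at h3
  refine (mul_eq_zero.mp h3).resolve_left (inv_ne_zero (neg_ne_zero.mpr (pow_ne_zero 2 ?_)))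
  exact Real.two_pi_pos.ne'

theorem distDeriv_zero (S : 𝓢'(Space d, ℂ)) : distDeriv 0 S = S := by
  simp [distDeriv, multiLength]

/-- A function of `B` has its second moment in `L²`. -/
theorem MemB.exists_normSq {f : L2 d} (hf : MemB f) : ∃ g : L2 d,
    TemperedDistribution.smulLeftCLM ℂ (fun x : Space d => ((‖x‖ ^ 2 : ℝ) : ℂ)) (toDist f)
      = toDist g := by
  have h : ∀ i : Fin d, ∃ g : L2 d, TemperedDistribution.smulLeftCLM ℂ
      (fun x : Space d => ((x i : ℝ) : ℂ) ^ 2) (toDist f) = toDist g := fun i => by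
    obtain ⟨g, hg⟩ := hf (Pi.single i 2) 0 (by simp [multiLength])
    refine ⟨g, ?_⟩
    rw [← hg, momentDeriv, distDeriv_zero]
    congr 2
    ext x
    rw [Finset.prod_eq_single i]
    · simp
    · intro j _ hj
      simp [Pi.single_eq_of_ne hj]
    · simp
  choose g hg using h
  refine ⟨∑ i, g i, ?_⟩
  have hx : (fun x : Space d => ((‖x‖ ^ 2 : ℝ) : ℂ)) =
      fun x => ∑ i, (fun x : Space d => ((x i : ℝ) : ℂ) ^ 2) x := by
    ext x
    rw [EuclideanSpace.norm_sq_eq]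
    simp
  rw [hx, TemperedDistribution.smulLeftCLM_sum, toDist_sum]
  · simp [hg]
  · intro i _
    have : (fun x : Space d => x i).HasTemperateGrowth :=
      (EuclideanSpace.proj (𝕜 := ℝ) i : Space d →L[ℝ] ℝ).hasTemperateGrowth
    fun_prop

/-- The generator of the evolution is skew-adjoint on `B`. -/
theorem re_inner_eq_zero_of_equation {f v : L2 d} (hf : MemB f) {k₁ k₂ : ℝ} (hk : k₁ ≠ 0)
    (h : toDist v + Complex.I • (-((k₁ : ℂ) • Δ (toDist f)) +
      (k₂ : ℂ) • TemperedDistribution.smulLeftCLM ℂ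
        (fun x : Space d => ((‖x‖ ^ 2 : ℝ) : ℂ)) (toDist f)) = 0) :
    (inner ℂ f v).re = 0 := by
  obtain ⟨g, hg⟩ := hf.exists_normSq
  have hk' : (k₁ : ℂ) ≠ 0 := by exact_mod_cast hk
  -- Membership in `B` puts `|x|² f` in `L²`; the equation, solved for `Δ f` using `k₁ ≠ 0`, then
  -- exhibits `Δ f` as the `L²` function `w`.
  set w : L2 d := (k₁ : ℂ)⁻¹ • ((k₂ : ℂ) • g + (-Complex.I) • v) with hw
  have hΔ : Δ (toDist f) = toDist w := by
    rw [hg] at h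
    have h1 : (k₁ : ℂ) • Δ (toDist f) = (k₂ : ℂ) • toDist g + (-Complex.I) • toDist v := by
      have h2 : (-Complex.I) • (toDist v + Complex.I • (-((k₁ : ℂ) • Δ (toDist f)) +
          (k₂ : ℂ) • toDist g)) = 0 := by
        rw [h]
        exact smul_zero (M := ℂ) (A := 𝓢'(Space d, ℂ)) _
      simp only [smul_add, smul_neg, smul_smul] at h2
      have h3 : -Complex.I * Complex.I = 1 := by simp
      rw [← mul_assoc, ← mul_assoc, h3, one_mul, one_mul] at h2
      rw [← sub_eq_zero, ← neg_eq_zero, ← h2]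
      abel
    rw [hw, toDist_smul, toDist_add, toDist_smul, toDist_smul, ← h1, smul_smul,
      inv_mul_cancel₀ hk', one_smul]
  have hv : v = Complex.I • ((k₁ : ℂ) • w + (-(k₂ : ℂ)) • g) := by
    rw [hw, smul_smul, mul_inv_cancel₀ hk', one_smul, neg_smul (k₂ : ℂ), add_neg_cancel_comm,
      smul_smul]
    simp
  have h1 := inner_laplacian_im_eq_zero hΔ
  have h2 := inner_normSq_im_eq_zero hg
  clear_value w
  rw [hv, inner_smul_right, inner_add_right, inner_smul_right, inner_smul_right]
  simp [Complex.mul_re, h1, h2]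

/-! ### Norm bound and slow variation of pairings along solutions. -/

namespace IsBValuedSolution

variable {κ₁ κ₂ : ℝ → ℝ} {T : ℝ} {u₀ : L2 d} {u : ℝ → L2 d}

theorem hasDerivAt (hu : IsBValuedSolution κ₁ κ₂ T u₀ u) {t : ℝ} (ht : t ∈ Ioo 0 T) :
    HasDerivAt u (derivWithin u (Icc 0 T) t) t :=
  ((hu.contDiff.differentiableOn one_ne_zero t (Ioo_subset_Icc_self ht)).hasDerivWithinAt).hasDerivAt
    (Icc_mem_nhds ht.1 ht.2)

/-- The `L²` norm does not increase along a solution. -/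
theorem norm_le (hu : IsBValuedSolution κ₁ κ₂ T u₀ u) (hκ : ∀ t ∈ Icc 0 T, κ₁ t ≠ 0) {t : ℝ}
    (ht : t ∈ Icc 0 T) : ‖u t‖ ≤ ‖u₀‖ := by
  have hder : ∀ s ∈ Ioo 0 T, HasDerivAt (fun s => (inner ℂ (u s) (u s) : ℂ).re) 0 s := by
    intro s hs
    have h1 := (hu.hasDerivAt hs).inner ℂ (hu.hasDerivAt hs)
    have h2 := (Complex.reCLM.hasFDerivAt.comp_hasDerivAt s h1)
    have h3 := re_inner_eq_zero_of_equation (hu.mem_B s (Ioo_subset_Icc_self hs))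
      (hκ s (Ioo_subset_Icc_self hs)) (hu.equation s (Ioo_subset_Ioc_self hs))
    have h4 : (inner ℂ (derivWithin u (Icc 0 T) s) (u s)).re = 0 := by
      rw [← inner_conj_symm, Complex.conj_re, h3]
    convert! h2 using 1
    simp [h3, h4]
  have hcont : ContinuousOn (fun s => (inner ℂ (u s) (u s) : ℂ).re) (Icc 0 T) :=
    Complex.continuous_re.comp_continuousOn
      (hu.contDiff.continuousOn.inner hu.contDiff.continuousOn)
  have h0 : (0 : ℝ) ∈ Icc 0 T := ⟨le_rfl, ht.1.trans ht.2⟩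
  have := (convex_Icc 0 T).image_sub_le_mul_sub_of_deriv_le hcont
    (fun s hs => by
      rw [interior_Icc] at hs
      exact (hder s hs).differentiableAt.differentiableWithinAt) (C := 0)
    (fun s hs => by
      rw [interior_Icc] at hs
      exact (hder s hs).deriv.le) 0 h0 t ht ht.1
  have hn : ∀ f : L2 d, (inner ℂ f f).re = ‖f‖ ^ 2 := fun f =>
    (norm_sq_eq_re_inner (𝕜 := ℂ) f).symm
  rw [hn, hn, zero_mul, hu.initial] at this
  exact le_of_sq_le_sq (by linarith) (norm_nonneg _)

/-- The pairing of a solution with a Schwartz function varies slowly. -/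
theorem pairing_ge (hu : IsBValuedSolution κ₁ κ₂ T u₀ u) (hκ : ∀ t ∈ Icc 0 T, κ₁ t ≠ 0)
    {K₁ K₂ : ℝ} (h₁ : ∀ t ∈ Icc 0 T, |κ₁ t| ≤ K₁) (h₂ : ∀ t ∈ Icc 0 T, |κ₂ t| ≤ K₂)
    (φ : 𝓢(Space d, ℂ)) {t : ℝ} (ht : t ∈ Icc 0 T) :
    (pairing φ u₀).re - (K₁ * ‖pairing (Δ φ)‖ + K₂ * ‖pairing (SchwartzMap.smulLeftCLM ℂ
      (fun x : Space d => ((‖x‖ ^ 2 : ℝ) : ℂ)) φ)‖) * ‖u₀‖ * t ≤ (pairing φ (u t)).re := by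
  set ψ := SchwartzMap.smulLeftCLM ℂ (fun x : Space d => ((‖x‖ ^ 2 : ℝ) : ℂ)) φ with hψ
  set L := K₁ * ‖pairing (Δ φ)‖ + K₂ * ‖pairing ψ‖ with hL
  have hder : ∀ s ∈ Ioo 0 T, HasDerivAt (fun s => (pairing φ (u s)).re)
      (pairing φ (derivWithin u (Icc 0 T) s)).re s := fun s hs =>
    Complex.reCLM.hasFDerivAt.comp_hasDerivAt s
      (((pairing φ).restrictScalars ℝ).hasFDerivAt.comp_hasDerivAt s (hu.hasDerivAt hs))
  have hcont : ContinuousOn (fun s => (pairing φ (u s)).re) (Icc 0 T) :=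
    Complex.continuous_re.comp_continuousOn
      ((pairing φ).continuous.comp_continuousOn hu.contDiff.continuousOn)
  have h0 : (0 : ℝ) ∈ Icc 0 T := ⟨le_rfl, ht.1.trans ht.2⟩
  have hbound : ∀ s ∈ Ioo 0 T, -(L * ‖u₀‖) ≤ (pairing φ (derivWithin u (Icc 0 T) s)).re := by
    intro s hs
    have hs' := Ioo_subset_Icc_self hs
    -- Testing the equation against `φ` moves both unbounded operators onto the Schwartz function,
    -- so only `‖u s‖` remains to be controlled.
    have h3 := congrArg (fun S : 𝓢'(Space d, ℂ) => S φ) (hu.equation s (Ioo_subset_Ioc_self hs))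
    have h4 : pairing φ (derivWithin u (Icc 0 T) s) +
        Complex.I * (-(κ₁ s * pairing (Δ φ) (u s)) + κ₂ s * pairing ψ (u s)) = 0 := by
      have h5 : Δ (toDist (u s)) φ = pairing (Δ φ) (u s) :=
        TemperedDistribution.laplacian_apply_apply _ _
      have h6 : TemperedDistribution.smulLeftCLM ℂ
        (fun x : Space d => ((‖x‖ ^ 2 : ℝ) : ℂ)) (toDist (u s)) φ = pairing ψ (u s) := rfl
      rw [← h5, ← h6]
      exact h3
    have hus := hu.norm_le hκ hs'
    have h7 : ‖pairing φ (derivWithin u (Icc 0 T) s)‖ ≤ L * ‖u₀‖ := by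
      rw [eq_neg_of_add_eq_zero_left h4, norm_neg, norm_mul, Complex.norm_I, one_mul]
      refine (norm_add_le _ _).trans ?_
      rw [norm_neg, norm_mul, norm_mul, Complex.norm_real, Complex.norm_real, Real.norm_eq_abs,
        Real.norm_eq_abs]
      have a1 : ‖pairing (Δ φ) (u s)‖ ≤ ‖pairing (Δ φ)‖ * ‖u₀‖ :=
        ((pairing (Δ φ)).le_opNorm _).trans (by gcongr)
      have a2 : ‖pairing ψ (u s)‖ ≤ ‖pairing ψ‖ * ‖u₀‖ :=
        ((pairing ψ).le_opNorm _).trans (by gcongr)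
      have b1 := mul_le_mul (h₁ s hs') a1 (norm_nonneg _) ((abs_nonneg _).trans (h₁ s hs'))
      have b2 := mul_le_mul (h₂ s hs') a2 (norm_nonneg _) ((abs_nonneg _).trans (h₂ s hs'))
      rw [hL]
      linarith
    exact (abs_le.mp ((Complex.abs_re_le_norm _).trans h7)).1
  have := (convex_Icc 0 T).mul_sub_le_image_sub_of_le_deriv hcont
    (fun s hs => by
      rw [interior_Icc] at hs
      exact (hder s hs).differentiableAt.differentiableWithinAt) (C := -(L * ‖u₀‖))
    (fun s hs => by
      rw [interior_Icc] at hs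
      rw [(hder s hs).deriv]
      exact hbound s hs) 0 h0 t ht ht.1
  rw [hu.initial] at this
  linarith

end IsBValuedSolution

end Oscillator

/-! ### Restriction to the exterior, Gaussian bounds and the bump. -/

namespace Oscillator

variable {d : ℕ}

theorem norm_sq_eq_integral (f : L2 d) : ‖f‖ ^ 2 = ∫ x, ‖f x‖ ^ 2 := by
  have h : (inner ℂ f f : ℂ) = ∫ x, ((‖f x‖ ^ 2 : ℝ) : ℂ) := by
    rw [L2.inner_def]
    refine integral_congr_ae (Filter.Eventually.of_forall fun x => ?_)
    simp only
    rw [inner_self_eq_norm_sq_to_K]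
    simp
  rw [norm_sq_eq_re_inner (𝕜 := ℂ), h, integral_complex_ofReal]
  rfl

/-- Multiplication of an `L²` function by the indicator of a set. -/
noncomputable def cutoff {ω : Set (Space d)} (hω : MeasurableSet ω) (f : L2 d) : L2 d :=
  ((Lp.memLp f).indicator hω).toLp _

section cutoff

variable {ω : Set (Space d)} (hω : MeasurableSet ω)

theorem coeFn_cutoff (f : L2 d) : cutoff hω f =ᵐ[volume] ω.indicator f :=
  MemLp.coeFn_toLp _

theorem norm_cutoff_sq (f : L2 d) : ‖cutoff hω f‖ ^ 2 = ∫ x in ω, ‖f x‖ ^ 2 := by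
  rw [norm_sq_eq_integral, ← integral_indicator hω]
  refine integral_congr_ae ?_
  filter_upwards [coeFn_cutoff hω f] with x hx
  rw [hx]
  by_cases h : x ∈ ω <;> simp [h]

theorem norm_cutoff_le (f : L2 d) : ‖cutoff hω f‖ ≤ ‖f‖ := by
  refine Lp.norm_le_norm_of_ae_le ?_
  filter_upwards [coeFn_cutoff hω f] with x hx
  rw [hx]
  exact norm_indicator_le_norm_self _ _

theorem cutoff_sub (f g : L2 d) : cutoff hω (f - g) = cutoff hω f - cutoff hω g := by
  refine Lp.ext ?_
  filter_upwards [coeFn_cutoff hω f, coeFn_cutoff hω g, coeFn_cutoff hω (f - g), Lp.coeFn_sub f g,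
    Lp.coeFn_sub (cutoff hω f) (cutoff hω g)] with x h1 h2 h3 h4 h5
  rw [h3, h5, Pi.sub_apply, h1, h2]
  by_cases h : x ∈ ω
  · simp only [indicator_of_mem h]
    exact h4
  · simp only [indicator_of_notMem h, sub_zero]

theorem continuous_cutoff : Continuous (cutoff hω : L2 d → L2 d) := by
  refine (LipschitzWith.of_dist_le_mul (K := 1) fun f g => ?_).continuous
  rw [dist_eq_norm, dist_eq_norm, ← cutoff_sub, NNReal.coe_one, one_mul]
  exact norm_cutoff_le hω _

theorem pairing_cutoff {φ : 𝓢(Space d, ℂ)} (hφ : ∀ x ∉ ω, φ x = 0) (f : L2 d) :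
    pairing φ (cutoff hω f) = pairing φ f := by
  rw [pairing_apply, pairing_apply, toDist_apply, toDist_apply]
  refine integral_congr_ae ?_
  filter_upwards [coeFn_cutoff hω f] with x hx
  rw [hx]
  by_cases h : x ∈ ω <;> simp [h, hφ]

/-- The time integral is restricted to `(0, t₀)`, where the integrand is at least `q²` when `q > 0`;
this is the source of the factor `√t₀`. -/
theorem le_spaceTimeNorm {u : ℝ → L2 d} {T t₀ q : ℝ} (hu : ContinuousOn u (Icc 0 T))
    (ht₀ : 0 ≤ t₀) (hT : t₀ ≤ T) (h : ∀ t ∈ Ioo 0 t₀, q ≤ ‖cutoff hω (u t)‖) :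
    Real.sqrt t₀ * q ≤ spaceTimeNorm u T ω := by
  rcases le_or_gt q 0 with hq | hq
  · exact (mul_nonpos_of_nonneg_of_nonpos (Real.sqrt_nonneg _) hq).trans (Real.sqrt_nonneg _)
  · have hsq : Real.sqrt t₀ * q = Real.sqrt (t₀ * q ^ 2) := by
      rw [Real.sqrt_mul ht₀, Real.sqrt_sq hq.le]
    rw [hsq, spaceTimeNorm]
    refine Real.sqrt_le_sqrt ?_
    simp_rw [← norm_cutoff_sq hω]
    have hint : IntegrableOn (fun t => ‖cutoff hω (u t)‖ ^ 2) (Ioo 0 T) := by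
      refine (ContinuousOn.integrableOn_Icc ?_).mono_set Ioo_subset_Icc_self
      exact (((continuous_cutoff hω).comp_continuousOn hu).norm).pow 2
    have hsub : Ioo 0 t₀ ⊆ Ioo 0 T := Ioo_subset_Ioo_right hT
    calc t₀ * q ^ 2 = ∫ _ in Ioo 0 t₀, q ^ 2 := by simp [ht₀]
      _ ≤ ∫ t in Ioo 0 t₀, ‖cutoff hω (u t)‖ ^ 2 := by
          refine setIntegral_mono_on (by simp) (hint.mono_set hsub) measurableSet_Ioo ?_
          intro t ht
          exact pow_le_pow_left₀ hq.le (h t ht) 2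
      _ ≤ _ := setIntegral_mono_set hint (Filter.Eventually.of_forall fun t => by positivity)
          hsub.eventuallyLE

end cutoff

section gaussian

theorem memLp_gaussian : MemLp (fun x : Space d => Real.exp (-‖x‖ ^ 2 / 2)) 2 volume := by
  rw [memLp_two_iff_integrable_sq (by fun_prop)]
  have h := GaussianFourier.integrable_cexp_neg_mul_sq_norm_add (b := 1) (by simp) 0 (0 : Space d)
  refine h.norm.congr (Filter.Eventually.of_forall fun x => ?_)
  simp only [Complex.norm_exp, ← Real.exp_nat_mul]
  congr 1
  simp [← Complex.ofReal_pow]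
  ring

variable {ι : Type*} {s : Finset ι} {a : ι → Space d} {c : ι → ℝ} {δ : ℝ}

/-- From `‖x‖² ≤ 2‖x + a‖² + 2‖a‖²`: halving the exponent absorbs the shift, so one fixed Gaussian
dominates all the translates. -/
theorem gaussian_sum_le (hc : ∀ n ∈ s, 0 ≤ c n) (ha : ∀ n ∈ s, ‖a n‖ ≤ δ) (x : Space d) :
    ∑ n ∈ s, c n * Real.exp (-‖x + a n‖ ^ 2) ≤
      (∑ n ∈ s, c n) * Real.exp (δ ^ 2) * Real.exp (-‖x‖ ^ 2 / 2) := by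
  rw [Finset.sum_mul, Finset.sum_mul]
  refine Finset.sum_le_sum fun n hn => ?_
  rw [mul_assoc, ← Real.exp_add]
  refine mul_le_mul_of_nonneg_left (Real.exp_le_exp.mpr ?_) (hc n hn)
  have h1 : ‖x‖ ≤ ‖x + a n‖ + ‖a n‖ := by
    simpa using norm_sub_le (x + a n) (a n)
  have h2 : ‖a n‖ ^ 2 ≤ δ ^ 2 := pow_le_pow_left₀ (norm_nonneg _) (ha n hn) 2
  have h3 : ‖x‖ ^ 2 ≤ (‖x + a n‖ + ‖a n‖) ^ 2 := pow_le_pow_left₀ (norm_nonneg _) h1 2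
  nlinarith [sq_nonneg (‖x + a n‖ - ‖a n‖)]

theorem le_gaussian_sum (hc : ∀ n ∈ s, 0 ≤ c n) (ha : ∀ n ∈ s, ‖a n‖ ≤ δ) {ρ : ℝ} {x : Space d}
    (hx : ‖x‖ ≤ ρ) :
    (∑ n ∈ s, c n) * Real.exp (-(ρ + δ) ^ 2) ≤ ∑ n ∈ s, c n * Real.exp (-‖x + a n‖ ^ 2) := by
  rw [Finset.sum_mul]
  refine Finset.sum_le_sum fun n hn => ?_
  refine mul_le_mul_of_nonneg_left (Real.exp_le_exp.mpr ?_) (hc n hn)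
  have h1 : ‖x + a n‖ ≤ ρ + δ := (norm_add_le _ _).trans (add_le_add hx (ha n hn))
  have := pow_le_pow_left₀ (norm_nonneg _) h1 2
  linarith

end gaussian

/-- In positive dimension there is a non-negative smooth bump outside any given ball. -/
theorem exists_bump (hd : 0 < d) (R : ℝ) : ∃ φ : 𝓢(Space d, ℂ), ∃ g : Space d → ℝ, ∃ ρ : ℝ,
    (∀ x, φ x = (g x : ℂ)) ∧ (∀ x, 0 ≤ g x) ∧ Integrable g ∧ 0 < ∫ x, g x ∧
    (∀ x, g x ≠ 0 → R < ‖x‖ ∧ ‖x‖ ≤ ρ) := by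
  -- With outer radius `2`, the support lies between the radii `|R| + 1` and `|R| + 5`.
  set x₀ : Space d := EuclideanSpace.single ⟨0, hd⟩ (|R| + 3) with hx₀
  have hn : ‖x₀‖ = |R| + 3 := by
    rw [hx₀, PiLp.norm_single, Real.norm_eq_abs, abs_of_nonneg (by positivity)]
  let b : ContDiffBump x₀ := ⟨1, 2, one_pos, by norm_num⟩
  have hc : HasCompactSupport (Complex.ofRealCLM ∘ b) := b.hasCompactSupport.comp_left rfl
  have hs : ContDiff ℝ (⊤ : ℕ∞) (Complex.ofRealCLM ∘ b) :=
    Complex.ofRealCLM.contDiff.comp b.contDiff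
  refine ⟨hc.toSchwartzMap hs, b, |R| + 5, fun x => rfl, fun x => b.nonneg, b.integrable,
    b.integral_pos, fun x hx => ?_⟩
  have h1 : x ∈ Metric.ball x₀ 2 := by
    rw [show (2 : ℝ) = b.rOut from rfl, ← b.support_eq]
    exact hx
  rw [mem_ball_iff_norm] at h1
  have h2 : ‖x₀‖ ≤ ‖x‖ + ‖x - x₀‖ := by
    have := norm_sub_le x (x - x₀)
    rwa [sub_sub_cancel] at this
  have h3 : ‖x‖ ≤ ‖x - x₀‖ + ‖x₀‖ := by
    have := norm_add_le (x - x₀) x₀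
    rwa [sub_add_cancel] at this
  constructor <;> linarith [le_abs_self R]

end Oscillator

/-! ### The observability estimate. -/

namespace Oscillator

variable {d : ℕ}

/-- An admissible function is within `η` of an `L²` Gaussian superposition. -/
theorem IsAdmissible.exists_near {N : ℕ} {η : ℝ} {a : (Fin d → ℕ) → Space d}
    {c : (Fin d → ℕ) → ℝ} {u₀ : L2 d} (h : IsAdmissible N η a c u₀) :
    ∃ f : L2 d, ‖u₀ - f‖ ≤ η ∧ ∀ᵐ x, f x =
      ((∑ n ∈ indexSet d N, c n * Real.exp (-‖x + a n‖ ^ 2) : ℝ) : ℂ) := by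
  set F : Space d → ℂ := fun x =>
    ((∑ n ∈ indexSet d N, c n * Real.exp (-‖x + a n‖ ^ 2) : ℝ) : ℂ) with hF
  have hFc : Continuous F := by
    rw [hF]
    fun_prop
  have h1 : MemLp (fun x => u₀ x - F x) 2 volume :=
    ⟨(Lp.memLp u₀).1.sub hFc.aestronglyMeasurable, h.approx.trans_lt ENNReal.ofReal_lt_top⟩
  have h2 : MemLp F 2 volume := by
    have := (Lp.memLp u₀).sub h1
    refine this.ae_eq (Filter.Eventually.of_forall fun x => ?_)
    simp
  refine ⟨h2.toLp F, ?_, h2.coeFn_toLp⟩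
  rw [Lp.norm_def]
  refine ENNReal.toReal_le_of_le_ofReal h.η_pos.le ?_
  refine le_trans (le_of_eq (eLpNorm_congr_ae ?_)) h.approx
  filter_upwards [Lp.coeFn_sub u₀ (h2.toLp F), h2.coeFn_toLp] with x h3 h4
  rw [h3, Pi.sub_apply, h4]

section superposition

variable {s : Finset (Fin d → ℕ)} {a : (Fin d → ℕ) → Space d} {c : (Fin d → ℕ) → ℝ} {δ : ℝ}
  {f : L2 d}

theorem norm_superposition_le (hc : ∀ n ∈ s, 0 ≤ c n) (ha : ∀ n ∈ s, ‖a n‖ ≤ δ)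
    (hf : ∀ᵐ x, f x = ((∑ n ∈ s, c n * Real.exp (-‖x + a n‖ ^ 2) : ℝ) : ℂ)) :
    ‖f‖ ≤ Real.exp (δ ^ 2) * ‖(memLp_gaussian (d := d)).toLp _‖ * ∑ n ∈ s, c n := by
  have h : ‖f‖ ≤ ((∑ n ∈ s, c n) * Real.exp (δ ^ 2)) * ‖(memLp_gaussian (d := d)).toLp _‖ := by
    refine Lp.norm_le_mul_norm_of_ae_le_mul ?_
    filter_upwards [hf, (memLp_gaussian (d := d)).coeFn_toLp] with x h1 h2
    rw [h1, h2, Complex.norm_real, Real.norm_eq_abs, Real.norm_eq_abs, Real.abs_exp, abs_of_nonneg]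
    · exact gaussian_sum_le hc ha x
    · exact Finset.sum_nonneg fun n hn => mul_nonneg (hc n hn) (Real.exp_pos _).le
  linarith

/-- Non-negativity of the coefficients and of `g` excludes cancellation: on the support of `g` each
translate is at least `exp(-(ρ + δ)²)`. With `norm_superposition_le`, it makes the pairing control
`‖f‖`. -/
theorem le_pairing_superposition (hc : ∀ n ∈ s, 0 ≤ c n) (ha : ∀ n ∈ s, ‖a n‖ ≤ δ)
    (hf : ∀ᵐ x, f x = ((∑ n ∈ s, c n * Real.exp (-‖x + a n‖ ^ 2) : ℝ) : ℂ))
    {φ : 𝓢(Space d, ℂ)} {g : Space d → ℝ} {ρ : ℝ} (hφ : ∀ x, φ x = (g x : ℂ))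
    (hg : ∀ x, 0 ≤ g x) (hint : Integrable g) (hρ : ∀ x, g x ≠ 0 → ‖x‖ ≤ ρ) :
    (Real.exp (-(ρ + δ) ^ 2) * ∫ x, g x) * ∑ n ∈ s, c n ≤ (pairing φ f).re := by
  set F : Space d → ℝ := fun x => ∑ n ∈ s, c n * Real.exp (-‖x + a n‖ ^ 2) with hF
  have hFc : Continuous F := by
    rw [hF]
    fun_prop
  have h1 : pairing φ f = ∫ x, ((F x * g x : ℝ) : ℂ) := by
    rw [pairing_apply, toDist_apply]
    refine integral_congr_ae ?_
    filter_upwards [hf] with x hx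
    rw [hx, hφ, mul_comm, ← Complex.ofReal_mul]
  have hS : 0 ≤ ∑ n ∈ s, c n := Finset.sum_nonneg hc
  have hFint : Integrable fun x => F x * g x := by
    refine hint.bdd_mul (c := (∑ n ∈ s, c n) * Real.exp (δ ^ 2)) hFc.aestronglyMeasurable
      (Filter.Eventually.of_forall fun x => ?_)
    rw [Real.norm_eq_abs, abs_of_nonneg
      (Finset.sum_nonneg fun n hn => mul_nonneg (hc n hn) (Real.exp_pos _).le)]
    refine (gaussian_sum_le hc ha x).trans (mul_le_of_le_one_right (by positivity) ?_)
    rw [Real.exp_le_one_iff]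
    have := sq_nonneg ‖x‖
    linarith
  rw [h1, integral_complex_ofReal, Complex.ofReal_re]
  calc (Real.exp (-(ρ + δ) ^ 2) * ∫ x, g x) * ∑ n ∈ s, c n
      = ∫ x, ((∑ n ∈ s, c n) * Real.exp (-(ρ + δ) ^ 2)) * g x := by
        rw [integral_const_mul]
        ring
    _ ≤ ∫ x, F x * g x := by
        refine integral_mono (hint.const_mul _) hFint fun x => ?_
        by_cases hx : g x = 0
        · simp [hx]
        · exact mul_le_mul_of_nonneg_right (le_gaussian_sum hc ha (hρ x hx)) (hg x)

end superposition

/-- Observability from the exterior of a ball, for data close to Gaussian superpositions with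
non-negative coefficients and centres in a bounded set. -/
theorem exists_observability_const (hd : 0 < d) {T : ℝ} (hT : 0 < T) (R K₁ K₂ δ : ℝ) :
    ∃ C : ℝ, 0 < C ∧ ∀ {ω : Set (Space d)}, MeasurableSet ω → (∀ x, R < ‖x‖ → x ∈ ω) →
      ∀ {κ₁ κ₂ : ℝ → ℝ}, (∀ t ∈ Icc 0 T, κ₁ t ≠ 0) → (∀ t ∈ Icc 0 T, |κ₁ t| ≤ K₁) →
      (∀ t ∈ Icc 0 T, |κ₂ t| ≤ K₂) →
      ∀ {N : ℕ} {η : ℝ} {a : (Fin d → ℕ) → Space d} {c : (Fin d → ℕ) → ℝ} {u₀ : L2 d}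
        {u : ℝ → L2 d}, (∀ n ∈ indexSet d N, ‖a n‖ ≤ δ) → IsAdmissible N η a c u₀ →
      IsBValuedSolution κ₁ κ₂ T u₀ u →
      ‖u₀‖ - η ≤ C * (spaceTimeNorm u T ω + T * η) := by
  obtain ⟨φ, g, ρ, hφ, hg, hint, hpos, hsupp⟩ := exists_bump hd R
  set γ := Real.exp (δ ^ 2) * ‖(memLp_gaussian (d := d)).toLp _‖ with hγ
  have hγ0 : 0 ≤ γ := by positivity
  set β := Real.exp (-(ρ + δ) ^ 2) * ∫ x, g x with hβ
  have hβ0 : 0 < β := mul_pos (Real.exp_pos _) hpos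
  set M := ‖pairing φ‖ + 1 with hM
  have hM0 : 0 < M := by positivity
  set L := |K₁| * ‖pairing (Δ φ)‖ + |K₂| * ‖pairing (SchwartzMap.smulLeftCLM ℂ
      (fun x : Space d => ((‖x‖ ^ 2 : ℝ) : ℂ)) φ)‖ with hL
  have hL0 : 0 ≤ L := by positivity
  -- Chosen so that the loss `LγS·t₀` is at most half of `βS`, uniformly in the data; the `+ 1`
  -- guards against `Lγ = 0`.
  set t₀ := min T (β / (2 * (L * γ + 1))) with ht₀
  have ht₀0 : 0 < t₀ := lt_min hT (by positivity)
  have ht₀T : t₀ ≤ T := min_le_left _ _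
  have ht₀β : t₀ * (L * γ) ≤ β / 2 := by
    have h1 : t₀ * (2 * (L * γ + 1)) ≤ β := by
      rw [← le_div_iff₀ (by positivity)]
      exact min_le_right _ _
    linarith
  set s₀ := Real.sqrt t₀ with hs₀
  have hs₀0 : 0 < s₀ := Real.sqrt_pos.mpr ht₀0
  refine ⟨γ * (2 / β) * (M / s₀ + (M + T * L) / T) + 1, by positivity, ?_⟩
  intro ω hω hRω κ₁ κ₂ hκ h₁ h₂ N η a c u₀ u ha hadm hu
  obtain ⟨f, hfη, hf⟩ := hadm.exists_near
  set S := ∑ n ∈ indexSet d N, c n with hS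
  have hη := hadm.η_pos
  have hfn : ‖f‖ ≤ γ * S := norm_superposition_le hadm.coeff_nonneg ha hf
  have hfp : β * S ≤ (pairing φ f).re :=
    le_pairing_superposition hadm.coeff_nonneg ha hf hφ hg hint fun x hx => (hsupp x hx).2
  have hS0 : 0 ≤ S := Finset.sum_nonneg hadm.coeff_nonneg
  have hu₀ : ‖u₀‖ ≤ η + γ * S := by
    have := norm_le_norm_add_norm_sub' u₀ f
    linarith
  have hu₀p : β * S - M * η ≤ (pairing φ u₀).re := by
    have e1 : pairing φ u₀ = pairing φ f + pairing φ (u₀ - f) := by rw [← map_add]; congr 1; abel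
    have e2 : ‖pairing φ (u₀ - f)‖ ≤ M * η :=
      ((pairing φ).le_opNorm _).trans
        (mul_le_mul (by linarith) hfη (norm_nonneg _) hM0.le)
    have e3 := (abs_le.mp ((Complex.abs_re_le_norm _).trans e2)).1
    rw [e1, Complex.add_re]
    linarith
  have hlow : ∀ t ∈ Ioo 0 t₀, (β / 2 * S - (M + T * L) * η) / M ≤ ‖cutoff hω (u t)‖ := by
    intro t ht
    have htT : t ∈ Icc 0 T := ⟨ht.1.le, ht.2.le.trans ht₀T⟩
    have e1 := hu.pairing_ge hκ (fun s hs => (h₁ s hs).trans (le_abs_self K₁))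
      (fun s hs => (h₂ s hs).trans (le_abs_self K₂)) φ htT
    rw [← hL, ← pairing_cutoff hω (fun x hx => ?_) (u t)] at e1
    · have e2 : (pairing φ (cutoff hω (u t))).re ≤ M * ‖cutoff hω (u t)‖ :=
        ((Complex.re_le_norm _).trans ((pairing φ).le_opNorm _)).trans
          (mul_le_mul_of_nonneg_right (by linarith) (norm_nonneg _))
      rw [div_le_iff₀ hM0]
      have e3 : L * ‖u₀‖ * t ≤ L * (η + γ * S) * t :=
        mul_le_mul_of_nonneg_right (mul_le_mul_of_nonneg_left hu₀ hL0) ht.1.le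
      have e4 : L * η * t ≤ L * η * T := mul_le_mul_of_nonneg_left htT.2 (by positivity)
      have e5 : (L * γ * S) * t ≤ (L * γ * S) * t₀ :=
        mul_le_mul_of_nonneg_left ht.2.le (by positivity)
      have e6 : t₀ * (L * γ) * S ≤ β / 2 * S := mul_le_mul_of_nonneg_right ht₀β hS0
      linarith
    · rw [hφ]
      by_contra hne
      exact hx (hRω x (hsupp x fun h0 => hne (by simp [h0])).1)
  have hst := le_spaceTimeNorm hω hu.contDiff.continuousOn ht₀0.le ht₀T hlow
  set X := spaceTimeNorm u T ω with hX
  have hX0 : 0 ≤ X := Real.sqrt_nonneg _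
  have hSle : S ≤ 2 / β * (M / s₀ * X + (M + T * L) * η) := by
    have e1 : β / 2 * S - (M + T * L) * η ≤ M / s₀ * X := by
      rw [div_mul_eq_mul_div M, le_div_iff₀ hs₀0]
      rw [← hs₀, ← mul_div_assoc, div_le_iff₀ hM0] at hst
      linarith
    have e2 : S = 2 / β * (β / 2 * S) := by field_simp
    rw [e2]
    exact mul_le_mul_of_nonneg_left (by linarith) (by positivity)
  have hfin : γ * S ≤ γ * (2 / β * (M / s₀ * X + (M + T * L) * η)) :=
    mul_le_mul_of_nonneg_left hSle hγ0
  -- Adding the two coefficients gives a single constant for `X + Tη`; the extra cross terms are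
  -- non-negative.
  have e7 : M / s₀ * X + (M + T * L) * η ≤ (M / s₀ + (M + T * L) / T) * (X + T * η) := by
    have : (M / s₀ + (M + T * L) / T) * (X + T * η) = M / s₀ * X + (M + T * L) * η +
        (M / s₀ * (T * η) + (M + T * L) / T * X) := by
      field_simp
      ring
    rw [this]
    have : 0 ≤ M / s₀ * (T * η) + (M + T * L) / T * X := by positivity
    linarith
  have e8 : γ * (2 / β) * (M / s₀ * X + (M + T * L) * η) ≤
      γ * (2 / β) * ((M / s₀ + (M + T * L) / T) * (X + T * η)) :=
    mul_le_mul_of_nonneg_left e7 (by positivity)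
  have e9 : 0 ≤ X + T * η := by positivity
  linarith

end Oscillator

/-! ### The Riccati system and the Gaussian width. -/

namespace Oscillator

/-- A function on `[0,T]` with non-negative derivative stays above its initial value. -/
theorem le_of_hasDerivWithinAt_nonneg {f f' : ℝ → ℝ} {T : ℝ}
    (h : ∀ t ∈ Icc 0 T, HasDerivWithinAt f (f' t) (Icc 0 T) t) (h' : ∀ t ∈ Icc 0 T, 0 ≤ f' t)
    {t : ℝ} (ht : t ∈ Icc 0 T) : f 0 ≤ f t := by
  have h1 := (convex_Icc 0 T).mul_sub_le_image_sub_of_le_deriv (f := f) (C := 0)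
    (fun s hs => (h s hs).continuousWithinAt)
    (fun s hs => by
      rw [interior_Icc] at hs ⊢
      exact ((h s (Ioo_subset_Icc_self hs)).hasDerivAt
        (Icc_mem_nhds hs.1 hs.2)).differentiableAt.differentiableWithinAt)
    (fun s hs => by
      rw [interior_Icc] at hs
      rw [((h s (Ioo_subset_Icc_self hs)).hasDerivAt (Icc_mem_nhds hs.1 hs.2)).deriv]
      exact h' s (Ioo_subset_Icc_self hs)) 0 ⟨le_rfl, ht.1.trans ht.2⟩ t ht ht.1
  linarith

namespace IsRiccatiSolution

variable {κ₁ κ₂ : ℝ → ℝ} {T : ℝ} {y₁ y₂ y₃ : ℝ → ℝ}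

theorem y₁_nonpos (h : IsRiccatiSolution κ₁ κ₂ T y₁ y₂ y₃) (hκ₁ : ∀ t ∈ Icc 0 T, 0 ≤ κ₁ t)
    (hκ₂ : ∀ t ∈ Icc 0 T, 0 ≤ κ₂ t) {t : ℝ} (ht : t ∈ Icc 0 T) : y₁ t ≤ 0 := by
  have := le_of_hasDerivWithinAt_nonneg (f := fun t => -y₁ t) (fun t ht => (h.deriv₁ t ht).neg)
    (fun t ht => by
      have := mul_nonneg (hκ₁ t ht) (sq_nonneg (y₁ t))
      linarith [hκ₂ t ht]) ht
  rw [h.init₁] at this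
  linarith

/-- `(y₂²)' = -8κ₁y₁y₂²` is non-negative because `y₁ ≤ 0`. -/
theorem one_le_abs_y₂ (h : IsRiccatiSolution κ₁ κ₂ T y₁ y₂ y₃) (hκ₁ : ∀ t ∈ Icc 0 T, 0 ≤ κ₁ t)
    (hκ₂ : ∀ t ∈ Icc 0 T, 0 ≤ κ₂ t) {t : ℝ} (ht : t ∈ Icc 0 T) : 1 ≤ |y₂ t| := by
  have := le_of_hasDerivWithinAt_nonneg (f := fun t => y₂ t * y₂ t)
    (fun t ht => (h.deriv₂ t ht).mul (h.deriv₂ t ht))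
    (fun t ht => by
      have := mul_nonneg (mul_nonneg (hκ₁ t ht) (neg_nonneg.mpr (h.y₁_nonpos hκ₁ hκ₂ ht)))
        (sq_nonneg (y₂ t))
      linarith) ht
  rw [h.init₂] at this
  rw [← one_le_sq_iff₀ (abs_nonneg _), sq_abs]
  linarith

/-- The quantity `(1 + 16 y₃²) / y₂²`, the squared width of the evolved Gaussian, is bounded above
and below. -/
theorem width_bounds (h : IsRiccatiSolution κ₁ κ₂ T y₁ y₂ y₃) (hκ₁ : ∀ t ∈ Icc 0 T, 0 ≤ κ₁ t)
    (hκ₂ : ∀ t ∈ Icc 0 T, 0 ≤ κ₂ t) {K₁ K₂ : ℝ} (h₁ : ∀ t ∈ Icc 0 T, κ₁ t ≤ K₁)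
    (h₂ : ∀ t ∈ Icc 0 T, κ₂ t ≤ K₂) {t : ℝ} (ht : t ∈ Icc 0 T) :
    (1 + 16 * y₃ t ^ 2) / y₂ t ^ 2 ≤ 5 * Real.exp (2 * (K₁ + K₂) * T) ∧
      1 ≤ (1 + 16 * y₃ t ^ 2) / y₂ t ^ 2 * (5 * Real.exp (2 * (K₁ + K₂) * T)) := by
  have hy : ∀ s ∈ Icc 0 T, y₂ s ≠ 0 := fun s hs h0 => by
    have := h.one_le_abs_y₂ hκ₁ hκ₂ hs
    rw [h0, abs_zero] at this
    linarith
  -- Linearisation: `(X, P)` and `(Z, Q)` both solve `x' = 2κ₁p`, `p' = -2κ₂x`, from `(1, 0)` and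
  -- `(0, -1/2)` respectively. The squared width is `X² + 16Z²`.
  set X : ℝ → ℝ := fun s => 1 / y₂ s with hX
  set P : ℝ → ℝ := fun s => 2 * y₁ s / y₂ s with hP
  set Z : ℝ → ℝ := fun s => y₃ s / y₂ s with hZ
  set Q : ℝ → ℝ := fun s => -y₂ s / 2 + 2 * y₁ s * y₃ s / y₂ s with hQ
  have dX : ∀ s ∈ Icc 0 T, HasDerivWithinAt X (2 * κ₁ s * P s) (Icc 0 T) s := fun s hs => by
    have := ((hasDerivWithinAt_const s (Icc 0 T) (1 : ℝ)).div (h.deriv₂ s hs) (hy s hs))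
    convert! this using 1
    have := hy s hs
    simp only [hP]
    field_simp
    ring
  have dP : ∀ s ∈ Icc 0 T, HasDerivWithinAt P (-2 * κ₂ s * X s) (Icc 0 T) s := fun s hs => by
    have := (((h.deriv₁ s hs).const_mul 2).div (h.deriv₂ s hs) (hy s hs))
    convert! this using 1
    have := hy s hs
    simp only [hX]
    field_simp
    ring
  have dZ : ∀ s ∈ Icc 0 T, HasDerivWithinAt Z (2 * κ₁ s * Q s) (Icc 0 T) s := fun s hs => by
    have := ((h.deriv₃ s hs).div (h.deriv₂ s hs) (hy s hs))
    convert! this using 1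
    have := hy s hs
    simp only [hQ]
    field_simp
    ring
  have dQ : ∀ s ∈ Icc 0 T, HasDerivWithinAt Q (-2 * κ₂ s * Z s) (Icc 0 T) s := fun s hs => by
    have := ((h.deriv₂ s hs).neg.div_const 2).add
      ((((h.deriv₁ s hs).const_mul 2).mul (h.deriv₃ s hs)).div (h.deriv₂ s hs) (hy s hs))
    convert! this using 1
    have := hy s hs
    simp only [hZ, Pi.mul_apply]
    field_simp
    ring
  set K := 2 * (K₁ + K₂) with hK
  -- The energy for Gronwall: `W(0) = 1 + 16/4 = 5`, and `W' = 4(κ₁ - κ₂)(XP + 16ZQ) ≤ KW` because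
  -- `|XP + 16ZQ| ≤ W/2`.
  set W : ℝ → ℝ := fun s => X s * X s + P s * P s + 16 * (Z s * Z s + Q s * Q s) with hW
  have hW5 : W t ≤ 5 * Real.exp (K * T) := by
    have h0 : (0 : ℝ) ∈ Icc 0 T := ⟨le_rfl, ht.1.trans ht.2⟩
    have hd : ∀ s ∈ Icc 0 T, HasDerivWithinAt (fun s => -(W s * Real.exp (-K * s)))
        ((K * W s - 4 * (κ₁ s - κ₂ s) * (X s * P s + 16 * (Z s * Q s))) * Real.exp (-K * s))
        (Icc 0 T) s := fun s hs => by
      have d1 := (((dX s hs).mul (dX s hs)).add ((dP s hs).mul (dP s hs))).add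
        ((((dZ s hs).mul (dZ s hs)).add ((dQ s hs).mul (dQ s hs))).const_mul 16)
      have d2 : HasDerivWithinAt (fun s => Real.exp (-K * s)) (Real.exp (-K * s) * (-K * 1))
          (Icc 0 T) s := (((hasDerivAt_id s).const_mul (-K)).exp).hasDerivWithinAt
      have d3 := (d1.mul d2).neg
      convert! d3 using 1
      simp only [hW, Pi.add_apply, Pi.mul_apply]
      ring
    have := le_of_hasDerivWithinAt_nonneg hd (fun s hs => by
      refine mul_nonneg ?_ (Real.exp_pos _).le
      have b1 := hκ₁ s hs
      have b2 := hκ₂ s hs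
      have b3 := h₁ s hs
      have b4 := h₂ s hs
      have e1 : |κ₁ s - κ₂ s| ≤ K₁ + K₂ := by
        rw [abs_le]
        constructor <;> linarith
      have e2 : |X s * P s + 16 * (Z s * Q s)| ≤ W s / 2 := by
        simp only [hW]
        rw [abs_le]
        constructor <;>
          nlinarith [sq_nonneg (X s - P s), sq_nonneg (Z s - Q s), sq_nonneg (X s + P s),
            sq_nonneg (Z s + Q s)]
      have e3 := mul_le_mul e1 e2 (abs_nonneg _) ((abs_nonneg _).trans e1)
      rw [← abs_mul] at e3
      have e4 := (abs_le.mp e3).2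
      rw [hK]
      linarith) ht
    have hW0 : W 0 = 5 := by
      simp only [hW, hX, hP, hZ, hQ, h.init₁, h.init₂, h.init₃]
      norm_num
    simp only [hW0, mul_zero, Real.exp_zero] at this
    have e1 : W t * Real.exp (-K * t) ≤ 5 := by linarith
    have e2 : W t = W t * Real.exp (-K * t) * Real.exp (K * t) := by
      rw [mul_assoc, ← Real.exp_add]
      simp
    have hK0 : 0 ≤ K := by linarith [hκ₁ t ht, hκ₂ t ht, h₁ t ht, h₂ t ht]
    rw [e2]
    exact mul_le_mul e1 (Real.exp_le_exp.mpr (mul_le_mul_of_nonneg_left ht.2 hK0))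
      (Real.exp_pos _).le (by norm_num)
  have hw : (1 + 16 * y₃ t ^ 2) / y₂ t ^ 2 = X t * X t + 16 * (Z t * Z t) := by
    have := hy t ht
    simp only [hX, hZ]
    field_simp
  -- The Wronskian of the two solutions keeps its initial value.
  have hwr : X t * Q t - P t * Z t = -1 / 2 := by
    have := hy t ht
    simp only [hX, hZ, hP, hQ]
    field_simp
    ring
  rw [hw]
  simp only [hW] at hW5
  set E := 5 * Real.exp (K * T) with hE
  refine ⟨by nlinarith [mul_self_nonneg (P t), mul_self_nonneg (Q t)], ?_⟩
  -- Lagrange's identity for `(X, 4Z)` and `(P, 4Q)`: the product is `(XP + 16ZQ)² + 16(XQ - PZ)²`,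
  -- whose last term is `4`. The second factor is at most `W`, so the width cannot be small.
  have e1 : 4 ≤ (X t * X t + 16 * (Z t * Z t)) * (P t * P t + 16 * (Q t * Q t)) := by
    nlinarith [sq_nonneg (X t * P t + 16 * (Z t * Q t))]
  have e2 : (X t * X t + 16 * (Z t * Z t)) * (P t * P t + 16 * (Q t * Q t)) ≤
      (X t * X t + 16 * (Z t * Z t)) * E := by
    refine mul_le_mul_of_nonneg_left ?_ (by nlinarith [mul_self_nonneg (X t), mul_self_nonneg (Z t)])
    nlinarith [mul_self_nonneg (X t), mul_self_nonneg (Z t)]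
  linarith

end IsRiccatiSolution

end Oscillator

/-! ### The smallness condition on the spacing. -/

namespace Oscillator

theorem integrableOn_exp_neg_mul_sq (R : ℝ) {b : ℝ} (hb : 0 < b) :
    IntegrableOn (fun r : ℝ => Real.exp (-b * r ^ 2)) (Ioi R) :=
  (integrable_exp_neg_mul_sq hb).integrableOn

theorem integral_Ioi_exp_neg_mul_sq_pos (R : ℝ) {b : ℝ} (hb : 0 < b) :
    0 < ∫ r in Ioi R, Real.exp (-b * r ^ 2) := by
  rw [setIntegral_pos_iff_support_of_nonneg_ae
    (Filter.Eventually.of_forall fun r => (Real.exp_pos _).le) (integrableOn_exp_neg_mul_sq R hb)]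
  have : Function.support (fun r : ℝ => Real.exp (-b * r ^ 2)) = univ := by
    ext r
    simp [Real.exp_ne_zero]
  rw [this, univ_inter]
  simp

/-- Two-sided width bounds and `N ≤ R₀` replace each time-dependent factor by a constant: the
bracket is bounded above, and `spread ≤ 2E` bounds the integral below. -/
theorem smallSpacing_of_le {R₀ E ε y₂ y₃ : ℝ} {N : ℕ} (hE : 1 ≤ E) (hy : 1 ≤ |y₂|)
    (h₁ : 1 + 16 * y₃ ^ 2 ≤ E * |y₂| ^ 2) (h₂ : |y₂| ^ 2 ≤ E * (1 + 16 * y₃ ^ 2))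
    (hN : (N : ℝ) ≤ R₀) (hε : 0 ≤ ε)
    (h : ε * N * (E * Real.exp (4 * E * R₀ ^ 2) +
        Real.sqrt (2 * Real.pi) * (R₀ + 1) * Real.exp (2 * R₀ ^ 2))
      ≤ 1 / 2 * ∫ r in Ioi R₀, Real.exp (-(2 * E) * r ^ 2)) :
    SmallSpacing R₀ N ε y₂ y₃ := by
  have hN0 : (0 : ℝ) ≤ N := Nat.cast_nonneg N
  have hR : 0 ≤ R₀ := hN0.trans hN
  set D := 1 + 16 * y₃ ^ 2 with hD
  have hD1 : 1 ≤ D := by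
    have := sq_nonneg y₃
    linarith
  have hD0 : 0 < D := by linarith
  set y := |y₂| with hydef
  have hy0 : 0 < y := by linarith
  have hyy : y ≤ y ^ 2 := by nlinarith
  have hNR : (N : ℝ) * R₀ ≤ R₀ ^ 2 := by nlinarith
  have hNN : (N : ℝ) ^ 2 ≤ R₀ ^ 2 := pow_le_pow_left₀ hN0 hN 2
  have b1 : Real.sqrt D / (2 * y) ≤ E := by
    rw [div_le_iff₀ (by positivity)]
    refine (Real.sqrt_le_sqrt h₁).trans ?_
    rw [Real.sqrt_le_left (by positivity)]
    nlinarith [mul_pos hy0 hy0, mul_nonneg (sub_nonneg.mpr hE) (mul_pos hy0 hy0).le]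
  have b2 : Real.exp ((2 * y ^ 2 * R₀ ^ 2 + 2 * y * N * R₀) / D) ≤
      Real.exp (4 * E * R₀ ^ 2) := by
    refine Real.exp_le_exp.mpr ?_
    rw [div_le_iff₀ hD0]
    have e1 : y * (N * R₀) ≤ y ^ 2 * R₀ ^ 2 := mul_le_mul hyy hNR (by positivity) (by positivity)
    have e2 : y ^ 2 * R₀ ^ 2 ≤ E * D * R₀ ^ 2 := mul_le_mul_of_nonneg_right h₂ (by positivity)
    linarith
  have b3 : ((N : ℝ) + 1) / y ≤ R₀ + 1 := (div_le_self (by positivity) hy).trans (by linarith)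
  have b4 : Real.exp (2 * (N : ℝ) ^ 2 / D) ≤ Real.exp (2 * R₀ ^ 2) :=
    Real.exp_le_exp.mpr ((div_le_self (by positivity) hD1).trans (by linarith))
  have hA : spread y₂ y₃ ≤ 2 * E := by
    rw [spread, div_le_iff₀ hD0]
    linarith
  have hA0 : 0 < spread y₂ y₃ := by
    rw [spread]
    positivity
  unfold SmallSpacing
  refine le_trans (mul_le_mul_of_nonneg_left ?_ (by positivity)) (h.trans ?_)
  · exact add_le_add (mul_le_mul b1 b2 (Real.exp_pos _).le (by positivity))
      (mul_le_mul (mul_le_mul_of_nonneg_left b3 (Real.sqrt_nonneg _)) b4 (Real.exp_pos _).le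
        (by positivity))
  · refine mul_le_mul_of_nonneg_left ?_ (by norm_num)
    refine setIntegral_mono_on (integrableOn_exp_neg_mul_sq R₀ (by positivity))
      (integrableOn_exp_neg_mul_sq R₀ hA0) measurableSet_Ioi fun r _ => ?_
    exact Real.exp_le_exp.mpr (mul_le_mul_of_nonneg_right (neg_le_neg hA) (sq_nonneg r))

/-- The smallness condition at the initial time. -/
theorem SmallSpacing.initial {R₀ ε : ℝ} {N : ℕ} (h : SmallSpacing R₀ N ε 1 0) (hε : 0 ≤ ε) :
    ε * N * Real.exp N ≤ 1 / 2 * ∫ r in Ioi R₀, Real.exp (-2 * r ^ 2) := by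
  have hN0 : (0 : ℝ) ≤ N := Nat.cast_nonneg N
  have hspread : spread 1 0 = 2 := by norm_num [spread]
  unfold SmallSpacing at h
  rw [hspread] at h
  refine le_trans (mul_le_mul_of_nonneg_left ?_ (by positivity)) h
  -- The true growth is `exp(2N²)`; `N ≤ N²` weakens it to the exponent linear in `N` that is
  -- needed.
  have e1 : Real.exp N ≤ Real.exp (2 * (N : ℝ) ^ 2 / (1 + 16 * 0 ^ 2)) := by
    refine Real.exp_le_exp.mpr ?_
    have : (N : ℝ) ≤ (N : ℝ) ^ 2 := by exact_mod_cast Nat.le_self_pow two_ne_zero N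
    norm_num
    linarith
  have e2 : 1 ≤ Real.sqrt (2 * Real.pi) := by
    rw [Real.one_le_sqrt]
    linarith [Real.pi_gt_three]
  have e3 : (1 : ℝ) ≤ (N + 1) / |1| := by
    rw [abs_one, div_one]
    linarith
  have e4 : 1 * Real.exp N ≤ Real.sqrt (2 * Real.pi) * ((N + 1) / |1|) *
      Real.exp (2 * (N : ℝ) ^ 2 / (1 + 16 * 0 ^ 2)) :=
    mul_le_mul (one_le_mul_of_one_le_of_one_le e2 e3) e1 (Real.exp_pos _).le (by positivity)
  rw [one_mul] at e4
  exact e4.trans (le_add_of_nonneg_left (by positivity))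

theorem norm_latticePoint_le {d N : ℕ} {n : Fin d → ℕ} (hn : n ∈ indexSet d N) :
    ‖latticePoint n‖ ≤ N := by
  rw [indexSet, Finset.mem_filter] at hn
  refine le_of_sq_le_sq ?_ (Nat.cast_nonneg N)
  rw [EuclideanSpace.norm_sq_eq]
  simp only [latticePoint, Real.norm_natCast]
  exact_mod_cast hn.2

end Oscillator

/-! ### Choice of constants and assembly. -/

theorem theorem2 (d : ℕ) (hd : 0 < d)
    (Ω : Set (Oscillator.Space d)) (hΩ_open : IsOpen Ω) (hΩ_conn : IsConnected Ω)
    (R₀ : ℝ) (hΩ_ball : Ω ⊆ Metric.ball 0 R₀)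
    (T : ℝ) (hT : 0 < T) (K₁ K₂ : ℝ) :
    ∃ C : ℝ, 0 < C ∧ ∃ C₁ C₂ C₁' C₂' : ℝ, 0 < C₁ ∧ 0 < C₂ ∧ 0 < C₁' ∧ 0 < C₂' ∧
      ∀ (T_D : EReal) (κ₁ κ₂ : ℝ → ℝ), (T : EReal) < T_D →
      ContDiffOn ℝ 1 κ₁ (Icc 0 T) → (∃ m : ℝ, 0 < m ∧ ∀ t ∈ Icc 0 T, m ≤ κ₁ t) →
      ContinuousOn κ₂ (Icc 0 T) → (∀ t ∈ Icc 0 T, 0 ≤ κ₂ t) →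
      (∀ t ∈ Icc 0 T, |κ₁ t| ≤ K₁ ∧ |derivWithin κ₁ (Icc 0 T) t| ≤ K₁) →
      (∀ t ∈ Icc 0 T, |κ₂ t| ≤ K₂) →
      (∀ S : ℝ, 0 < S → (S : EReal) < T_D → Oscillator.FlowNonzero d κ₁ κ₂ S) →
      ∀ y₁ y₂ y₃ : ℝ → ℝ, Oscillator.IsRiccatiSolution κ₁ κ₂ T y₁ y₂ y₃ →
        (∀ (N : ℕ) (ε η : ℝ) (c : (Fin d → ℕ) → ℝ) (u₀ : Oscillator.L2 d)
            (u : ℝ → Oscillator.L2 d), 0 < ε →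
          Oscillator.IsAdmissible N η (fun n => ε • Oscillator.latticePoint n) c u₀ →
          Oscillator.IsBValuedSolution κ₁ κ₂ T u₀ u →
          (∀ t ∈ Icc 0 T, Oscillator.SmallSpacing R₀ N ε (y₂ t) (y₃ t)) →
          ‖u₀‖ - η ≤ C * (Oscillator.spaceTimeNorm u T (closure Ω)ᶜ + T * η)) ∧
        (∀ (N : ℕ) (ε : ℝ), 2 < N → 2 * (N : ℝ) < Metric.diam Ω → 0 < ε →
          ε ≤ Real.exp (-C₁ * N) / (C₂ * N) →
          ∀ t ∈ Icc 0 T, Oscillator.SmallSpacing R₀ N ε (y₂ t) (y₃ t)) ∧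
        (∀ (N : ℕ) (ε : ℝ), 2 < N → 0 < ε →
          (∀ t ∈ Icc 0 T, Oscillator.SmallSpacing R₀ N ε (y₂ t) (y₃ t)) →
          ε ≤ Real.exp (-C₁' * N) / (C₂' * N)) := by
  have hR₀ : 0 < R₀ := by
    obtain ⟨x, hx⟩ := hΩ_conn.nonempty
    exact Metric.pos_of_mem_ball (hΩ_ball hx)
  set I := ∫ r in Ioi R₀, Real.exp (-2 * r ^ 2) with hI
  have hI0 : 0 < I := Oscillator.integral_Ioi_exp_neg_mul_sq_pos R₀ two_pos
  obtain ⟨C, hC, hobs⟩ :=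
    -- The radius `I / 2` for the centres comes from the condition at `t = 0`, which gives `εN ≤
    -- εN·exp N ≤ I / 2`.
    Oscillator.exists_observability_const hd hT R₀ K₁ K₂ (1 / 2 * I)
  set E := 5 * Real.exp (2 * (|K₁| + |K₂|) * T) with hE
  have hE1 : 1 ≤ E := by
    have := Real.one_le_exp (show 0 ≤ 2 * (|K₁| + |K₂|) * T by positivity)
    linarith
  set J := ∫ r in Ioi R₀, Real.exp (-(2 * E) * r ^ 2) with hJ
  have hJ0 : 0 < J := Oscillator.integral_Ioi_exp_neg_mul_sq_pos R₀ (by positivity)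
  set M := E * Real.exp (4 * E * R₀ ^ 2) +
    Real.sqrt (2 * Real.pi) * (R₀ + 1) * Real.exp (2 * R₀ ^ 2) with hM
  have hM0 : 0 < M := by positivity
  refine ⟨C, hC, 1, 2 * M / J, 1, 2 / I, one_pos, by positivity, one_pos, by positivity, ?_⟩
  intro T_D κ₁ κ₂ _ _ hκ₁ _ hκ₂ hK₁ hK₂ _ y₁ y₂ y₃ hy
  obtain ⟨m, hm, hmκ⟩ := hκ₁
  have hκ₁0 : ∀ t ∈ Icc 0 T, 0 ≤ κ₁ t := fun t ht => hm.le.trans (hmκ t ht)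
  have hinit : ∀ {N : ℕ} {ε : ℝ}, 0 < ε →
      (∀ t ∈ Icc 0 T, Oscillator.SmallSpacing R₀ N ε (y₂ t) (y₃ t)) →
      ε * N * Real.exp N ≤ 1 / 2 * I := fun {N ε} hε h => by
    have h0 := h 0 ⟨le_rfl, hT.le⟩
    rw [hy.init₂, hy.init₃] at h0
    exact h0.initial hε.le
  refine ⟨?_, ?_, ?_⟩
  · intro N ε η c u₀ u hε hadm hu hsmall
    refine hobs isClosed_closure.measurableSet.compl (fun x hx hxΩ => ?_)
      (fun t ht => (hm.trans_le (hmκ t ht)).ne') (fun t ht => (hK₁ t ht).1) hK₂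
      (fun n hn => ?_) hadm hu
    · have := closure_mono hΩ_ball hxΩ
      have := Metric.closure_ball_subset_closedBall this
      rw [mem_closedBall_zero_iff] at this
      linarith
    · rw [norm_smul, Real.norm_eq_abs, abs_of_pos hε]
      calc ε * ‖Oscillator.latticePoint n‖ ≤ ε * N :=
            mul_le_mul_of_nonneg_left (Oscillator.norm_latticePoint_le hn) hε.le
        _ ≤ ε * N * Real.exp N :=
            le_mul_of_one_le_right (by positivity) (Real.one_le_exp (Nat.cast_nonneg N))
        _ ≤ 1 / 2 * I := hinit hε hsmall
  · intro N ε hN hdiam hε hεN t ht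
    have hNpos : (0 : ℝ) < N := by exact_mod_cast (by omega : 0 < N)
    have hy1 := hy.one_le_abs_y₂ hκ₁0 hκ₂ ht
    have hy2 : 0 < y₂ t ^ 2 := by
      rw [← sq_abs]
      positivity
    obtain ⟨w₁, w₂⟩ := hy.width_bounds hκ₁0 hκ₂
      (fun t ht => (le_abs_self _).trans ((hK₁ t ht).1.trans (le_abs_self K₁)))
      (fun t ht => (le_abs_self _).trans ((hK₂ t ht).trans (le_abs_self K₂))) ht
    rw [← hE, div_le_iff₀ hy2] at w₁
    rw [← hE, div_mul_eq_mul_div, le_div_iff₀ hy2, one_mul] at w₂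
    refine Oscillator.smallSpacing_of_le hE1 hy1 (by rwa [sq_abs]) (by rw [sq_abs]; linarith)
      ?_ hε.le ?_
    -- The diameter restriction on `N` serves to give `N ≤ R₀`.
    · have h1 : Metric.diam Ω ≤ 2 * R₀ :=
        (Metric.diam_mono hΩ_ball Metric.isBounded_ball).trans (Metric.diam_ball hR₀.le)
      linarith
    · rw [← hM, ← hJ]
      rw [le_div_iff₀ (by positivity)] at hεN
      -- As `N` is bounded by `R₀`, only `ε ≤ J / (2MN)` is needed here and the exponential factor
      -- can be dropped.
      have h1 : Real.exp (-1 * N) ≤ 1 := Real.exp_le_one_iff.mpr (by linarith)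
      have h2 : ε * N * M = ε * (2 * M / J * N) * (J / 2) := by field_simp
      rw [h2]
      have := mul_le_mul_of_nonneg_right (hεN.trans h1) (half_pos hJ0).le
      linarith
  · intro N ε hN hε hsmall
    have hNpos : (0 : ℝ) < N := by exact_mod_cast (by omega : 0 < N)
    have h1 := hinit hε hsmall
    rw [le_div_iff₀ (by positivity), neg_one_mul, Real.exp_neg, ← one_div,
      le_div_iff₀ (Real.exp_pos _)]
    have h2 : ε * (2 / I * N) * Real.exp N = 2 / I * (ε * N * Real.exp N) := by ring
    rw [h2]
    calc 2 / I * (ε * N * Real.exp N) ≤ 2 / I * (1 / 2 * I) :=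
          mul_le_mul_of_nonneg_left h1 (by positivity)
      _ = 1 := by field_simp
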